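/- Let $A\in\mathbb R^{n\times n}$ and $B\in\mathbb R^{n\times m}$, where $A$ has eigenvalues $\lambda_1,\dots,\lambda_n\in\mathbb C$ with $|\lambda_1|>\dots>|\lambda_k|>1>|\lambda_{k+1}|>\dots>|\lambda_n|$ for some $0\le k\le n$. Let $E_u\subseteq\mathbb R^n$ be the invariant subspace of $A$ belonging to $\lambda_1,\dots,\lambda_k$. For a matrix $P_1\in\mathbb R^{n\times k}$ whose columns form an orthonormal basis of $E_u$, put $M_1=P_1^*AP_1$ and $B_\tau=P_1^*A^{\tau-1}B$ for $\tau\ge 1$. A pair $(F,G)\in\mathbb R^{k\times k}\times\mathbb R^{k\times m}$ is *stabilizable* if $\rho(F+GK)<1$ for some $K\in\mathbb R^{m\times k}$, where $\rho$ is the spectral radius. Norms are Euclidean norms of vectors and spectral norms of matrices. **Proposition.** If $(A,B)$ is controllable, then there is $\tau_0\ge 1$ such that for every $\tau\ge\tau_0$ both of the following hold. (a) There is $\delta_0>0$ such that, for every $P_1$ as above and all $\hat M_1\in\mathbb R^{k\times k}$, $\hat B_\tau\in\mathbb R^{k\times m}$ with $\|\hat M_1^\tau-M_1^\tau\|<\delta_0$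 and $\|\hat B_\tau-B_\tau\|<\delta_0$, the pair $(\hat M_1^\tau,\hat B_\tau)$ is stabilizable. (b) For every $\alpha>0$ there are $\gamma_0,\delta_0>0$ such that, for all $\gamma\in(0,\gamma_0)$, $\delta\in(0,\delta_0)$, every $C$, every $T\in\mathbb N$ and every noise sequence with $\|\eta_t\|<C$, the following holds for every run of the following learning procedure on $x_{t+1}=Ax_t+Bu_t+\eta_t$, $x_0=0$, in which all the stopping times below are finite. With $\varepsilon=\delta/\sqrt{2k}$ (and $\varepsilon=0$ if $k=0$): 1. The input is $u_t=0$ at all times up to the end of the last round of step 3, except at the injection times of step 3. 2. $\hat P_1\in\mathbb R^{n\times k}$ consists of the top $k$ left singular vectors of $D=[x_1,\dots,x_T]$, and $\hat M_1\in\mathbb R^{k\times k}$ minimizes $M\mapsto\sum_{t=0}^{T}\|\hat P_1^*x_{t+1}-M\hat P_1^*x_t\|^2$. 3. For $i=1,\dots,m$ in turn, starting at time $T$ if $i=1$ and $\tau$ steps after the previous injection otherwise, wait until the first time $t_i$ at which $x_{t_i}\neq0$, $\|(I-\hat P_1\hat P_1^*)x_{t_i}\|/\|x_{t_i}\|<(1-\varepsilon)\gamma$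 and $C/\|x_{t_i}\|<\delta$. Inject $u_{t_i}=\alpha\|x_{t_i}\|e_i$ and let $\tau$ steps elapse. The $i$-th column of $\hat B_\tau$ is $\hat b_i=\frac{1}{\alpha\|x_{t_i}\|}\bigl(\hat P_1^*x_{t_i+\tau}-\hat M_1^\tau\hat P_1^*x_{t_i}\bigr)$. If the estimation errors satisfy $\|\hat P_1-P_1\|<\delta_0$ and $\|\hat M_1-M_1\|<\delta_0$ for some $P_1$ as above, then $(\hat M_1^\tau,\hat B_\tau)$ is stabilizable. -/

import Mathlib

open scoped Matrix Matrix.Norms.L2Operator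

noncomputable section

namespace LTSZero

/-- The Euclidean norm of a vector given by its coordinates. -/
def vnorm {ι : Type*} [Fintype ι] (v : ι → ℝ) : ℝ := ‖WithLp.toLp 2 v‖

/-- The state at time `t` of `x_{s+1} = A x_s + B u_s` started at `x₀`. -/
def linState {n m : ℕ} (A : Matrix (Fin n) (Fin n) ℝ) (B : Matrix (Fin n) (Fin m) ℝ)
    (x₀ : Fin n → ℝ) (u : ℕ → Fin m → ℝ) : ℕ → Fin n → ℝ
  | 0 => x₀
  | t + 1 => A *ᵥ linState A B x₀ u t + B *ᵥ u t

/-- `(A, B)` is controllable: every state can be steered to every other state in finite time. -/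
def Controllable {n m : ℕ} (A : Matrix (Fin n) (Fin n) ℝ) (B : Matrix (Fin n) (Fin m) ℝ) : Prop :=
  ∀ x₀ x₁ : Fin n → ℝ, ∃ (N : ℕ) (u : ℕ → Fin m → ℝ), linState A B x₀ u N = x₁

/-- A real matrix regarded as a complex one. -/
def toComplex {ι κ : Type*} (A : Matrix ι κ ℝ) : Matrix ι κ ℂ := A.map ((↑) : ℝ → ℂ)

/-- `(F, G)` is stabilizable: some real state feedback `u = K y` makes the spectral radius of the
closed-loop matrix `F + G K` less than one. -/
def Stabilizable {k m : ℕ} (F : Matrix (Fin k) (Fin k) ℝ) (G : Matrix (Fin k) (Fin m) ℝ) : Prop :=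
  ∃ K : Matrix (Fin m) (Fin k) ℝ, spectralRadius ℂ (toComplex (F + G * K)) < 1

/-- `lam 0, …, lam (n-1)` are the (complex) eigenvalues of `A`, with
`|lam 0| > ⋯ > |lam (k-1)| > 1 > |lam k| > ⋯ > |lam (n-1)|`. As the moduli are distinct, these
are `n` distinct eigenvalues, hence all of them, and `A` is diagonalizable. -/
structure SpectralProperty {n : ℕ} (A : Matrix (Fin n) (Fin n) ℝ) (k : ℕ) (lam : Fin n → ℂ) :
    Prop where
  le : k ≤ n
  eigen : ∀ i, Module.End.HasEigenvalue (Matrix.toLin' (toComplex A)) (lam i)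
  strict : ∀ i j, i < j → ‖lam j‖ < ‖lam i‖
  unstable : ∀ i : Fin n, (i : ℕ) < k → 1 < ‖lam i‖
  stable : ∀ i : Fin n, k ≤ (i : ℕ) → ‖lam i‖ < 1

/-- The unstable subspace `E_u` of `A`: the real vectors lying in the sum of the (generalized)
complex eigenspaces of `A` for the eigenvalues of modulus greater than one. -/
def unstableSubspace {n : ℕ} (A : Matrix (Fin n) (Fin n) ℝ) : Submodule ℝ (Fin n → ℝ) :=
  ((⨆ μ : {μ : ℂ // 1 < ‖μ‖},
    Module.End.maxGenEigenspace (Matrix.toLin' (toComplex A)) (μ : ℂ)).restrictScalars ℝ).comap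
      (LinearMap.compLeft (Complex.ofRealCLM : ℝ →ₗ[ℝ] ℂ) (Fin n))

/-- The columns of `P₁` form an orthonormal basis of the unstable subspace of `A`. -/
def IsUnstableBasis {n k : ℕ} (A : Matrix (Fin n) (Fin n) ℝ) (P₁ : Matrix (Fin n) (Fin k) ℝ) :
    Prop :=
  P₁ᵀ * P₁ = 1 ∧ LinearMap.range (Matrix.mulVecLin P₁) = unstableSubspace A

/-- `M₁ = P₁* A P₁`, the upper left block of `P⁻¹ A P` for an orthogonal `P = [P₁, P₂]`. -/
def unstableBlock {n k : ℕ} (A : Matrix (Fin n) (Fin n) ℝ) (P₁ : Matrix (Fin n) (Fin k) ℝ) :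
    Matrix (Fin k) (Fin k) ℝ :=
  P₁ᵀ * A * P₁

/-- `B_τ = P₁* A^(τ-1) B` (used for `τ ≥ 1` only). -/
def hopInput {n m k : ℕ} (A : Matrix (Fin n) (Fin n) ℝ) (B : Matrix (Fin n) (Fin m) ℝ)
    (P₁ : Matrix (Fin n) (Fin k) ℝ) (τ : ℕ) : Matrix (Fin k) (Fin m) ℝ :=
  P₁ᵀ * A ^ (τ - 1) * B

/-- The columns of `W` are the first `k` columns of `U` in a singular value decomposition
`D = U Σ V*` with non-increasing singular values `σ 0 ≥ σ 1 ≥ ⋯ ≥ 0`. -/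
def IsTopLeftSingular {n T k : ℕ} (D : Matrix (Fin n) (Fin T) ℝ) (W : Matrix (Fin n) (Fin k) ℝ) :
    Prop :=
  ∃ (hk : k ≤ n) (U : Matrix (Fin n) (Fin n) ℝ) (V : Matrix (Fin T) (Fin T) ℝ) (σ : ℕ → ℝ),
    U ∈ Matrix.orthogonalGroup (Fin n) ℝ ∧ V ∈ Matrix.orthogonalGroup (Fin T) ℝ ∧
    Antitone σ ∧ (∀ i, 0 ≤ σ i) ∧
    D = U * Matrix.of (fun (i : Fin n) (j : Fin T) => if (i : ℕ) = j then σ i else 0) * Vᵀ ∧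
    W = U.submatrix id (Fin.castLE hk)

/-- The data matrix `D = [x_1, …, x_T]`. -/
def dataMatrix {n : ℕ} (x : ℕ → Fin n → ℝ) (T : ℕ) : Matrix (Fin n) (Fin T) ℝ :=
  Matrix.of fun i j => x ((j : ℕ) + 1) i

/-- The least-squares loss `∑_{t=0}^T ‖W* x_{t+1} - M W* x_t‖²`. -/
def lsLoss {n k : ℕ} (x : ℕ → Fin n → ℝ) (T : ℕ) (W : Matrix (Fin n) (Fin k) ℝ)
    (M : Matrix (Fin k) (Fin k) ℝ) : ℝ :=
  ∑ t ∈ Finset.range (T + 1), vnorm (Wᵀ *ᵥ x (t + 1) - M *ᵥ (Wᵀ *ᵥ x t)) ^ 2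

/-- The criterion `‖(I - W W*) x‖ / ‖x‖ < (1 - ε) γ` and `C / ‖x‖ < δ`, with `x ≠ 0`. -/
def StopCond {n k : ℕ} (W : Matrix (Fin n) (Fin k) ℝ) (C ε γ δ : ℝ) (x : Fin n → ℝ) : Prop :=
  vnorm (x - (W * Wᵀ) *ᵥ x) < (1 - ε) * γ * vnorm x ∧ C < δ * vnorm x

/-- The time at which the control input of round `i` is injected:
`T`, plus the waiting times of the rounds up to `i`, plus `τ` steps for each earlier round. -/
def injTime {m : ℕ} (T τ : ℕ) (ω : Fin m → ℕ) (i : Fin m) : ℕ :=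
  T + (∑ j ∈ Finset.Iic i, ω j) + (i : ℕ) * τ

/-- A run of the learning phase of the algorithm LTS₀-N on the system
`x_{t+1} = A x_t + B u_t + η_t`, `x_0 = 0`, `‖η_t‖ < C`, with the parameters `α, γ, δ, T, τ` and
`ε = δ / √(2k)`: `Phat` are the top `k` left singular vectors of `[x_1, …, x_T]`, `Mhat` is a
least-squares estimate, `ω` are the waiting times and `Bhat` is the estimate of `B_τ`. -/
structure IsRun {n m k : ℕ} (A : Matrix (Fin n) (Fin n) ℝ) (B : Matrix (Fin n) (Fin m) ℝ)
    (C α γ δ : ℝ) (T τ : ℕ) (η x : ℕ → Fin n → ℝ) (u : ℕ → Fin m → ℝ) (ω : Fin m → ℕ)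
    (Phat : Matrix (Fin n) (Fin k) ℝ) (Mhat : Matrix (Fin k) (Fin k) ℝ)
    (Bhat : Matrix (Fin k) (Fin m) ℝ) : Prop where
  noise : ∀ t, vnorm (η t) < C
  init : x 0 = 0
  dynamics : ∀ t, x (t + 1) = A *ᵥ x t + B *ᵥ u t + η t
  subspace : IsTopLeftSingular (dataMatrix x T) Phat
  leastSquares : ∀ M, lsLoss x T Phat Mhat ≤ lsLoss x T Phat M
  stopping : ∀ i, StopCond Phat C (δ / √(2 * k)) γ δ (x (injTime T τ ω i))
  -- the waiting times are minimal
  first : ∀ i, ∀ s < ω i, ¬ StopCond Phat C (δ / √(2 * k)) γ δ (x (injTime T τ ω i - ω i + s))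
  inject : ∀ i, u (injTime T τ ω i) = (α * vnorm (x (injTime T τ ω i))) • Pi.single i 1
  -- open loop at all other times, until the last round ends
  openLoop : ∀ t, (∃ i, t < injTime T τ ω i + τ) → (∀ i, t ≠ injTime T τ ω i) → u t = 0
  estimate : ∀ i, Bhat.col i = (1 / (α * vnorm (x (injTime T τ ω i)))) •
    (Phatᵀ *ᵥ x (injTime T τ ω i + τ) - (Mhat ^ τ) *ᵥ (Phatᵀ *ᵥ x (injTime T τ ω i)))

end LTSZero

end

/-! Both parts rest on one robust fact: for large `τ` some feedback `K` makes the closed loop `M₁^τ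
+ B_τ K` nilpotent. Nilpotency makes a power of the closed loop vanish, and having a power of norm
below one is an open condition implying spectral radius below one, so the same `K` works for all
nearby pairs (`exists_forall_stabilizable`).

To find `K`, let `w` be a left eigenvector of `A` for an unstable eigenvalue `λ`. Then `w P₁`
satisfies the left eigenvector equation of `M₁^τ` for `λ^τ`, and `w P₁ B_τ` equals `λ^(τ-1) w B`
minus a term that tends to 0, because the part of `A^t B` orthogonal to `E_u` decays.
Controllability gives `w B ≠ 0`, so no unstable mode is lost once `τ` is large
(`eventually_exists_nilpotent_hop`). The numbers `λ^τ` have distinct moduli, so a single input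
direction excites all modes and deadbeat control applies (`exists_nilpotent_feedback`). Two bases of
`E_u` differ by an orthogonal matrix, which makes the tolerance uniform in `P₁`.

For (b), the stopping rule makes the state almost lie in `E_u` and dominate the noise. After
division by `α‖x‖`, each column of the estimate of `B_τ` is therefore accurate up to a constant
times the small parameters (`IsRun.exists_estimate_le`). -/

namespace LTSZero

open Filter Topology Polynomial

/-! ### Complexification and left eigenvectors -/

section Complexification

variable {ι κ ν : Type*}

lemma toComplex_mul [Fintype κ] (A : Matrix ι κ ℝ) (B : Matrix κ ν ℝ) :
    toComplex (A * B) = toComplex A * toComplex B :=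
  Matrix.map_mul (f := Complex.ofRealHom)

lemma toComplex_one [DecidableEq ι] : toComplex (1 : Matrix ι ι ℝ) = 1 :=
  Matrix.map_one _ Complex.ofReal_zero Complex.ofReal_one

lemma toComplex_sub (A B : Matrix ι κ ℝ) : toComplex (A - B) = toComplex A - toComplex B :=
  Matrix.map_sub _ Complex.ofReal_sub A B

lemma toComplex_pow [Fintype ι] [DecidableEq ι] (A : Matrix ι ι ℝ) (N : ℕ) :
    toComplex (A ^ N) = toComplex A ^ N :=
  map_pow (Complex.ofRealHom.mapMatrix (m := ι)) A N

lemma toComplex_mulVec [Fintype κ] (A : Matrix ι κ ℝ) (v : κ → ℝ) :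
    toComplex A *ᵥ (fun j => (v j : ℂ)) = fun i => ((A *ᵥ v) i : ℂ) := by
  funext i
  simp [toComplex, Matrix.mulVec, dotProduct]

end Complexification

lemma vecMul_pow_eigen {ι : Type*} [Fintype ι] [DecidableEq ι] {A : Matrix ι ι ℂ} {μ : ℂ}
    {q : ι → ℂ} (hq : q ᵥ* A = μ • q) (N : ℕ) : q ᵥ* A ^ N = μ ^ N • q := by
  induction N with
  | zero => simp
  | succ N ih => rw [pow_succ, ← Matrix.vecMul_vecMul, ih, Matrix.smul_vecMul, hq, smul_smul,
      pow_succ]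

lemma mulVec_pow_eigen {ι : Type*} [Fintype ι] [DecidableEq ι] {A : Matrix ι ι ℂ} {μ : ℂ}
    {q : ι → ℂ} (hq : A *ᵥ q = μ • q) (N : ℕ) : A ^ N *ᵥ q = μ ^ N • q := by
  induction N with
  | zero => simp
  | succ N ih => rw [pow_succ, ← Matrix.mulVec_mulVec, hq, Matrix.mulVec_smul, ih, smul_smul,
      pow_succ']

lemma vecMul_aeval_eigen {ι : Type*} [Fintype ι] [DecidableEq ι] {F : Matrix ι ι ℝ} {μ : ℂ}
    {q : ι → ℂ} (hq : q ᵥ* toComplex F = μ • q) (r : ℝ[X]) :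
    q ᵥ* toComplex (aeval F r) = (aeval μ r) • q := by
  induction r using Polynomial.induction_on' with
  | add r s hr hs =>
    have : toComplex (aeval F (r + s)) = toComplex (aeval F r) + toComplex (aeval F s) := by
      rw [map_add]; exact Matrix.map_add _ Complex.ofReal_add _ _
    rw [this, Matrix.vecMul_add, hr, hs, map_add, add_smul]
  | monomial N a =>
    have : toComplex (aeval F (monomial N a)) = (a : ℂ) • toComplex F ^ N := by
      rw [aeval_monomial, ← toComplex_pow]
      ext i j
      simp [toComplex, Matrix.algebraMap_eq_diagonal, Matrix.diagonal_mul]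
    rw [this, Matrix.vecMul_smul, vecMul_pow_eigen hq, smul_smul, aeval_monomial]
    rfl

/-- Pairing `r(F) g` with `q i` gives `r(μ i) (q i · g)`, so `r` has `k` distinct roots. In other
words, `g` is a cyclic vector for `F`. -/
lemma aeval_mulVec_eq_zero {k : ℕ} {F : Matrix (Fin k) (Fin k) ℝ} {g : Fin k → ℝ}
    {μ : Fin k → ℂ} (hμ : Function.Injective μ) {q : Fin k → Fin k → ℂ}
    (hq : ∀ i, q i ᵥ* toComplex F = μ i • q i)
    (hg : ∀ i, q i ⬝ᵥ (fun j => (g j : ℂ)) ≠ 0) {r : ℝ[X]} (hr : r.degree < k)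
    (h : aeval F r *ᵥ g = 0) : r = 0 := by
  have hroot : ∀ i, aeval (μ i) r = 0 := by
    intro i
    have h1 : q i ⬝ᵥ (toComplex (aeval F r) *ᵥ fun j => (g j : ℂ)) = 0 := by
      rw [toComplex_mulVec, h]
      simp [dotProduct]
    rw [Matrix.dotProduct_mulVec, vecMul_aeval_eigen (hq i), smul_dotProduct, smul_eq_mul] at h1
    exact (mul_eq_zero.1 h1).resolve_right (hg i)
  have h2 : r.map (algebraMap ℝ ℂ) = 0 := by
    refine Polynomial.eq_zero_of_degree_lt_of_eval_finset_eq_zero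
      (Finset.univ.map ⟨μ, hμ⟩) ?_ ?_
    · simpa using hr
    · intro x hx
      obtain ⟨i, -, rfl⟩ := Finset.mem_map.1 hx
      simpa [aeval_def, eval_map] using hroot i
  exact (Polynomial.map_eq_zero _).1 h2

/-! ### Deadbeat control through Horner vectors -/

lemma coeff_divX_iterate (p : ℝ[X]) (i N : ℕ) : (divX^[i] p).coeff N = p.coeff (N + i) := by
  induction i generalizing N with
  | zero => rfl
  | succ i ih => rw [Function.iterate_succ_apply', coeff_divX, ih]; congr 1; ring

/-- The Horner vectors `(χ divided i times by X)(F) g` of the characteristic polynomial `χ`. -/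
noncomputable def hornerVec {k : ℕ} (F : Matrix (Fin k) (Fin k) ℝ) (g : Fin k → ℝ) (i : ℕ) : Fin k → ℝ :=
  aeval F (divX^[i] F.charpoly) *ᵥ g

lemma hornerVec_zero {k : ℕ} (F : Matrix (Fin k) (Fin k) ℝ) (g : Fin k → ℝ) :
    hornerVec F g 0 = 0 := by
  simp [hornerVec, Matrix.aeval_self_charpoly]

lemma hornerVec_eq {k : ℕ} (F : Matrix (Fin k) (Fin k) ℝ) (g : Fin k → ℝ) (i : ℕ) :
    hornerVec F g i = F *ᵥ hornerVec F g (i + 1) + F.charpoly.coeff i • g := by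
  have h := divX_mul_X_add (divX^[i] F.charpoly)
  rw [coeff_divX_iterate, zero_add, ← Function.iterate_succ_apply' divX, mul_comm] at h
  rw [hornerVec, ← h, map_add, map_mul, aeval_X, aeval_C, Matrix.add_mulVec, hornerVec,
    Matrix.mulVec_mulVec, Algebra.algebraMap_eq_smul_one, Matrix.smul_mulVec, Matrix.one_mulVec]

/-- The polynomials behind the vectors are monic of the distinct degrees `k - 1, …, 0`, hence
independent, and cyclicity of `g` carries this over to the vectors. -/
lemma linearIndependent_hornerVec {k : ℕ} {F : Matrix (Fin k) (Fin k) ℝ} {g : Fin k → ℝ}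
    (hF : ∀ r : ℝ[X], r.degree < k → aeval F r *ᵥ g = 0 → r = 0) :
    LinearIndependent ℝ fun i : Fin k => hornerVec F g (i + 1) := by
  have hdeg : F.charpoly.natDegree = k := by simp [Matrix.charpoly_natDegree_eq_dim]
  have htop : F.charpoly.coeff k = 1 := by
    have := F.charpoly_monic.coeff_natDegree
    rwa [hdeg] at this
  rw [Fintype.linearIndependent_iff]
  intro c hc
  set r : ℝ[X] := ∑ i : Fin k, C (c i) * divX^[(i : ℕ) + 1] F.charpoly with hr
  have hcoeff : ∀ N, r.coeff N = ∑ i : Fin k, c i * F.charpoly.coeff (N + (i + 1)) := by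
    intro N
    rw [hr, finsetSum_coeff]
    exact Finset.sum_congr rfl fun i _ => by rw [coeff_C_mul, coeff_divX_iterate]
  have hr0 : r = 0 := by
    refine hF r ?_ ?_
    · rw [degree_lt_iff_coeff_zero]
      intro N hN
      rw [hcoeff]
      refine Finset.sum_eq_zero fun i _ => ?_
      rw [coeff_eq_zero_of_natDegree_lt (by omega), mul_zero]
    · rw [← hc, hr, map_sum, Matrix.sum_mulVec]
      refine Finset.sum_congr rfl fun i _ => ?_
      rw [map_mul, aeval_C, Algebra.algebraMap_eq_smul_one, smul_mul_assoc, one_mul,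
        Matrix.smul_mulVec, hornerVec]
  -- Triangular elimination: in the coefficient of `X^(k-1-i)`, terms with larger index vanish by
  -- degree, those with smaller index by induction.
  have key : ∀ N : ℕ, ∀ i : Fin k, (i : ℕ) = N → c i = 0 := by
    intro N
    induction N using Nat.strong_induction_on with
    | _ N ih =>
      intro i hi
      have h := hcoeff (k - 1 - i)
      rw [hr0, coeff_zero, Finset.sum_eq_single i] at h
      · rw [show k - 1 - (i : ℕ) + (i + 1) = k by omega, htop, mul_one] at h
        exact h.symm
      · intro j _ hj
        have hj' : (j : ℕ) ≠ i := fun h => hj (Fin.ext h)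
        rcases lt_or_gt_of_ne hj' with h1 | h1
        · rw [ih j (by omega) j rfl, zero_mul]
        · rw [coeff_eq_zero_of_natDegree_lt (by omega), mul_zero]
      · simp
  exact fun i => key i i rfl

/-- Deadbeat control: a pair whose first entry has distinct eigenvalues, none of them
uncontrollable, is made nilpotent by a suitable feedback. -/
theorem exists_nilpotent_feedback {k m : ℕ} {F : Matrix (Fin k) (Fin k) ℝ}
    {G : Matrix (Fin k) (Fin m) ℝ} {μ : Fin k → ℂ} (hμ : Function.Injective μ)
    {q : Fin k → Fin k → ℂ} (hq : ∀ i, q i ᵥ* toComplex F = μ i • q i)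
    (hG : ∀ i, q i ᵥ* toComplex G ≠ 0) :
    ∃ K : Matrix (Fin m) (Fin k) ℝ, (F + G * K) ^ k = 0 := by
  -- Reduction to a single input: each mode excludes a proper real subspace of directions `c`, and
  -- finitely many of these cannot cover `ℝ^m`.
  obtain ⟨c, hc⟩ : ∃ c : Fin m → ℝ, ∀ i, q i ⬝ᵥ (fun j => ((G *ᵥ c) j : ℂ)) ≠ 0 := by
    let φ (i : Fin k) : (Fin m → ℝ) →ₗ[ℝ] ℂ :=
      { toFun := fun c => (q i ᵥ* toComplex G) ⬝ᵥ fun j => (c j : ℂ)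
        map_add' := fun x y => by simp [dotProduct, mul_add, Finset.sum_add_distrib]
        map_smul' := fun a x => by
          simp only [dotProduct, Pi.smul_apply, smul_eq_mul, Complex.ofReal_mul, RingHom.id_apply,
            Complex.real_smul, Finset.mul_sum]
          exact Finset.sum_congr rfl fun j _ => by ring }
    by_contra! hcon
    have hun : ⋃ i, ((LinearMap.ker (φ i) : Submodule ℝ (Fin m → ℝ)) : Set (Fin m → ℝ)) =
        Set.univ := by
      rw [Set.eq_univ_iff_forall]
      intro c
      obtain ⟨i, hi⟩ := hcon c
      refine Set.mem_iUnion.2 ⟨i, ?_⟩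
      rw [← toComplex_mulVec, Matrix.dotProduct_mulVec] at hi
      exact hi
    obtain ⟨i, hi⟩ := Subspace.exists_eq_top_of_iUnion_eq_univ hun
    refine hG i (funext fun j => ?_)
    have h : φ i (Pi.single j 1) = 0 := by
      rw [← LinearMap.mem_ker, hi]; trivial
    have h2 : (fun l => ((Pi.single j (1 : ℝ) : Fin m → ℝ) l : ℂ)) = Pi.single j 1 := by
      funext l
      by_cases hl : l = j
      · subst hl; simp
      · simp [hl]
    simpa [φ, h2] using h
  set g := G *ᵥ c with hg
  have hli := linearIndependent_hornerVec (F := F) (g := g)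
    fun r hr h => aeval_mulVec_eq_zero hμ hq hc hr h
  have hspan := hli.span_eq_top_of_card_eq_finrank' (by simp)
  let b := Module.Basis.mk hli hspan.ge
  -- These values turn the Horner recursion into a shift: the closed loop sends each basis vector to
  -- the preceding Horner vector, and the zeroth is 0 by Cayley–Hamilton.
  let L : (Fin k → ℝ) →ₗ[ℝ] (Fin m → ℝ) := b.constr ℝ fun i => F.charpoly.coeff i • c
  refine ⟨LinearMap.toMatrix' L, ?_⟩
  set N := F + G * LinearMap.toMatrix' L with hN
  have hstep : ∀ i, i < k → N *ᵥ hornerVec F g (i + 1) = hornerVec F g i := by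
    intro i hi
    have hL : L (hornerVec F g (i + 1)) = F.charpoly.coeff i • c := by
      have h1 : b ⟨i, hi⟩ = hornerVec F g (i + 1) := by simp [b]
      rw [← h1]
      exact b.constr_basis ℝ _ _
    rw [hN, Matrix.add_mulVec, ← Matrix.mulVec_mulVec, LinearMap.toMatrix'_mulVec, hL,
      Matrix.mulVec_smul, ← hg, ← hornerVec_eq]
  have hpow : ∀ i, i ≤ k → N ^ i *ᵥ hornerVec F g i = 0 := by
    intro i
    induction i with
    | zero => intro _; simp [hornerVec_zero]
    | succ i ih =>
      intro hi
      rw [pow_succ, ← Matrix.mulVec_mulVec, hstep i (by omega), ih (by omega)]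
  have hzero : Matrix.mulVecLin (N ^ k) = 0 := by
    refine b.ext fun i => ?_
    have h1 : b i = hornerVec F g (i + 1) := by simp [b]
    rw [h1, Matrix.mulVecLin_apply, LinearMap.zero_apply,
      show N ^ k = N ^ (k - (i + 1)) * N ^ ((i : ℕ) + 1) by rw [← pow_add]; congr 1; omega,
      ← Matrix.mulVec_mulVec, hpow _ i.2, Matrix.mulVec_zero]
  exact Matrix.ext_of_mulVec_single fun i => by
    rw [Matrix.zero_mulVec]
    exact LinearMap.congr_fun hzero (Pi.single i 1)

/-! ### Robustness and invariance of stabilizability -/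

lemma spectralRadius_lt_one {k : ℕ} {M : Matrix (Fin k) (Fin k) ℂ} {N : ℕ}
    (h : ‖M ^ (N + 1)‖ < 1) : spectralRadius ℂ M < 1 := by
  have hone : ‖(1 : Matrix (Fin k) (Fin k) ℂ)‖₊ ≤ 1 := by
    rw [← Matrix.diagonal_one, Matrix.l2_opNNNorm_diagonal]
    exact pi_nnnorm_le_iff.2 fun _ => by simp
  have hpos : (0 : ℝ) < 1 / (N + 1) := by positivity
  refine (spectrum.spectralRadius_le_pow_nnnorm_pow_one_div ℂ M N).trans_lt ?_
  have h1 : ((‖M ^ (N + 1)‖₊ : ENNReal)) ^ (1 / (N + 1) : ℝ) < 1 := by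
    refine ENNReal.rpow_lt_one ?_ hpos
    exact_mod_cast h
  have h2 : ((‖(1 : Matrix (Fin k) (Fin k) ℂ)‖₊ : ENNReal)) ^ (1 / (N + 1) : ℝ) ≤ 1 :=
    ENNReal.rpow_le_one (by exact_mod_cast hone) hpos.le
  exact (mul_le_of_le_one_right' h2).trans_lt h1

/-- Stabilizability by a deadbeat feedback persists under small perturbations. -/
theorem exists_forall_stabilizable {k m : ℕ} {F : Matrix (Fin k) (Fin k) ℝ}
    {G : Matrix (Fin k) (Fin m) ℝ} {K : Matrix (Fin m) (Fin k) ℝ} (hK : (F + G * K) ^ k = 0) :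
    ∃ δ : ℝ, 0 < δ ∧ ∀ (F' : Matrix (Fin k) (Fin k) ℝ) (G' : Matrix (Fin k) (Fin m) ℝ),
      ‖F' - F‖ < δ → ‖G' - G‖ < δ → Stabilizable F' G' := by
  let f : Matrix (Fin k) (Fin k) ℝ × Matrix (Fin k) (Fin m) ℝ → Matrix (Fin k) (Fin k) ℂ :=
    fun p => toComplex (p.1 + p.2 * K) ^ (k + 1)
  have hmap : Continuous (toComplex : Matrix (Fin k) (Fin k) ℝ → Matrix (Fin k) (Fin k) ℂ) :=
    continuous_id.matrix_map Complex.continuous_ofReal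
  have hcont : Continuous f :=
    (hmap.comp (continuous_fst.add (continuous_snd.matrix_mul continuous_const))).pow _
  have h0 : f (F, G) = 0 := by
    simp only [f]
    rw [← toComplex_pow, pow_succ, hK, zero_mul]
    ext i j
    simp [toComplex]
  have hev : ∀ᶠ p in 𝓝 (F, G), ‖f p‖ < 1 := by
    have h1 : Tendsto (fun p => ‖f p‖) (𝓝 (F, G)) (𝓝 0) := by
      have := hcont.norm.tendsto (F, G)
      rwa [h0, norm_zero] at this
    exact h1.eventually_lt_const one_pos
  obtain ⟨δ, hδ, h⟩ := Metric.eventually_nhds_iff.1 hev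
  refine ⟨δ, hδ, fun F' G' hF hG => ⟨K, ?_⟩⟩
  refine spectralRadius_lt_one (N := k) (h (y := (F', G')) ?_)
  rw [Prod.dist_eq, dist_eq_norm, dist_eq_norm]
  exact max_lt hF hG

/-- Stabilizability is invariant under an orthogonal change of coordinates. -/
lemma stabilizable_of_orthogonal {k m : ℕ} {F : Matrix (Fin k) (Fin k) ℝ}
    {G : Matrix (Fin k) (Fin m) ℝ} {O : Matrix (Fin k) (Fin k) ℝ} (hO : Oᵀ * O = 1)
    (h : Stabilizable (O * F * Oᵀ) (O * G)) : Stabilizable F G := by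
  obtain ⟨K, hK⟩ := h
  have hO' : O * Oᵀ = 1 := mul_eq_one_comm.1 hO
  refine ⟨K * O, ?_⟩
  let U : (Matrix (Fin k) (Fin k) ℂ)ˣ :=
    ⟨toComplex O, toComplex Oᵀ, by rw [← toComplex_mul, hO', toComplex_one],
      by rw [← toComplex_mul, hO, toComplex_one]⟩
  have h1 : toComplex (O * F * Oᵀ + O * G * K) =
      (U : Matrix (Fin k) (Fin k) ℂ) * toComplex (F + G * (K * O)) *
        ((U⁻¹ : (Matrix (Fin k) (Fin k) ℂ)ˣ) : Matrix (Fin k) (Fin k) ℂ) := by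
    change _ = toComplex O * _ * toComplex Oᵀ
    rw [← toComplex_mul, ← toComplex_mul]
    congr 1
    rw [Matrix.mul_add, Matrix.add_mul]
    congr 1
    simp only [Matrix.mul_assoc, hO', Matrix.mul_one]
  have h2 : spectralRadius ℂ (toComplex (F + G * (K * O))) =
      spectralRadius ℂ (toComplex (O * F * Oᵀ + O * G * K)) := by
    rw [spectralRadius, spectralRadius, h1, spectrum.units_conjugate]
  rwa [h2]

end LTSZero

/-! ### The unstable subspace and its orthonormal bases -/

namespace LTSZero

open Filter Topology

variable {n m k : ℕ} {A : Matrix (Fin n) (Fin n) ℝ} {B : Matrix (Fin n) (Fin m) ℝ}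
  {lam : Fin n → ℂ} {P P' : Matrix (Fin n) (Fin k) ℝ}

/-- The sum of the generalized complex eigenspaces for eigenvalues of modulus above one. -/
noncomputable def complexUnstable (A : Matrix (Fin n) (Fin n) ℝ) : Submodule ℂ (Fin n → ℂ) :=
  ⨆ μ : {μ : ℂ // 1 < ‖μ‖},
    Module.End.maxGenEigenspace (Matrix.toLin' (toComplex A)) (μ : ℂ)

lemma mem_unstableSubspace {v : Fin n → ℝ} :
    v ∈ unstableSubspace A ↔ (fun i => (v i : ℂ)) ∈ complexUnstable A :=
  Iff.rfl

lemma mem_complexUnstable_of_eigen {μ : ℂ} (hμ : 1 < ‖μ‖) {v : Fin n → ℂ}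
    (hv : toComplex A *ᵥ v = μ • v) : v ∈ complexUnstable A := by
  have h : v ∈ Module.End.maxGenEigenspace (Matrix.toLin' (toComplex A)) μ := by
    refine (Module.End.mem_maxGenEigenspace _ _ _).2 ⟨1, ?_⟩
    rw [pow_one, LinearMap.sub_apply, Matrix.toLin'_apply, hv]
    simp
  exact Submodule.mem_iSup_of_mem (p := fun μ : {μ : ℂ // 1 < ‖μ‖} =>
    Module.End.maxGenEigenspace (Matrix.toLin' (toComplex A)) (μ : ℂ)) ⟨μ, hμ⟩ h

lemma toComplex_mulVec_star {v : Fin n → ℂ} {μ : ℂ} (hv : toComplex A *ᵥ v = μ • v) :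
    toComplex A *ᵥ star v = star μ • star v := by
  have h := congrArg star hv
  rw [star_smul] at h
  rw [← h]
  funext i
  simp [toComplex, Matrix.mulVec, dotProduct]

lemma mulVec_mem_unstableSubspace {v : Fin n → ℝ} (hv : v ∈ unstableSubspace A) :
    A *ᵥ v ∈ unstableSubspace A := by
  rw [mem_unstableSubspace] at hv ⊢
  rw [← toComplex_mulVec]
  have hle : complexUnstable A ≤
      (complexUnstable A).comap (Matrix.toLin' (toComplex A)) :=
    iSup_le fun μ w hw => Submodule.mem_iSup_of_mem μ
      (Module.End.mapsTo_maxGenEigenspace_of_comm (Commute.refl _) _ hw)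
  exact hle hv

namespace IsUnstableBasis

lemma proj_mulVec (hP : IsUnstableBasis A P) {v : Fin n → ℝ} (hv : v ∈ unstableSubspace A) :
    (P * Pᵀ) *ᵥ v = v := by
  rw [← hP.2] at hv
  obtain ⟨z, rfl⟩ := hv
  rw [Matrix.mulVecLin_apply, Matrix.mulVec_mulVec, Matrix.mul_assoc, hP.1, Matrix.mul_one]

lemma mulVec_mem (hP : IsUnstableBasis A P) (z : Fin k → ℝ) : P *ᵥ z ∈ unstableSubspace A := by
  rw [← hP.2]; exact ⟨z, rfl⟩

lemma proj_mul (hP : IsUnstableBasis A P) (hP' : IsUnstableBasis A P') :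
    P * Pᵀ * P' = P' :=
  Matrix.ext_of_mulVec_single fun i => by
    rw [← Matrix.mulVec_mulVec]
    exact hP.proj_mulVec (hP'.mulVec_mem _)

lemma proj_mul_mul (hP : IsUnstableBasis A P) : P * Pᵀ * (A * P) = A * P :=
  Matrix.ext_of_mulVec_single fun i => by
    rw [← Matrix.mulVec_mulVec, ← Matrix.mulVec_mulVec (M := A)]
    exact hP.proj_mulVec (mulVec_mem_unstableSubspace (hP.mulVec_mem _))

lemma mul_eq (hP : IsUnstableBasis A P) : A * P = P * unstableBlock A P := by
  conv_lhs => rw [← hP.proj_mul_mul]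
  simp only [unstableBlock, Matrix.mul_assoc]

lemma pow_mul_eq (hP : IsUnstableBasis A P) (N : ℕ) : A ^ N * P = P * unstableBlock A P ^ N := by
  induction N with
  | zero => simp
  | succ N ih => rw [pow_succ, Matrix.mul_assoc, hP.mul_eq, ← Matrix.mul_assoc, ih,
      Matrix.mul_assoc, ← pow_succ]

lemma block_pow (hP : IsUnstableBasis A P) (N : ℕ) :
    unstableBlock A P ^ N = Pᵀ * A ^ N * P := by
  rw [Matrix.mul_assoc, hP.pow_mul_eq, ← Matrix.mul_assoc, hP.1, Matrix.one_mul]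

/-- As `A` is real, the conjugate of `v` is an eigenvector for the conjugate of `μ`, of the same
modulus. Hence the real and imaginary parts of `v` lie in the real unstable subspace. -/
lemma proj_mulVec_eigen (hP : IsUnstableBasis A P) {μ : ℂ} (hμ : 1 < ‖μ‖) {v : Fin n → ℂ}
    (hv : toComplex A *ᵥ v = μ • v) : toComplex (P * Pᵀ) *ᵥ v = v := by
  have h1 := mem_complexUnstable_of_eigen hμ hv
  have h2 : star v ∈ complexUnstable A :=
    mem_complexUnstable_of_eigen (μ := star μ) (by rwa [norm_star]) (toComplex_mulVec_star hv)
  have hre : (fun i => (v i).re) ∈ unstableSubspace A := by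
    rw [mem_unstableSubspace]
    convert (complexUnstable A).smul_mem (1 / 2 : ℂ) ((complexUnstable A).add_mem h1 h2) using 1
    funext i
    simp [Complex.re_eq_add_conj]
    ring
  have him : (fun i => (v i).im) ∈ unstableSubspace A := by
    rw [mem_unstableSubspace]
    convert (complexUnstable A).smul_mem (1 / (2 * Complex.I))
      ((complexUnstable A).sub_mem h1 h2) using 1
    funext i
    simp [Complex.im_eq_sub_conj]
    ring_nf
    simp only [Complex.inv_I]
    ring
  have hdec : v = (fun i => ((v i).re : ℂ)) + Complex.I • fun i => ((v i).im : ℂ) := by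
    funext i
    simp [mul_comm Complex.I, Complex.re_add_im]
  rw [hdec, Matrix.mulVec_add, Matrix.mulVec_smul, toComplex_mulVec, toComplex_mulVec,
    hP.proj_mulVec hre, hP.proj_mulVec him]

/-- The component of `A ^ t b` orthogonal to the unstable subspace decays. -/
lemma tendsto_orthogonal (hP : IsUnstableBasis A P) (hA : SpectralProperty A k lam)
    (b : Fin n → ℂ) :
    Tendsto (fun t : ℕ => toComplex (1 - P * Pᵀ) *ᵥ (toComplex A ^ t *ᵥ b)) atTop (𝓝 0) := by
  choose v hv using fun i => (hA.eigen i).exists_hasEigenvector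
  have hinj : Function.Injective lam := by
    intro i j hij
    by_contra hne
    rcases lt_or_gt_of_ne hne with h | h
    · exact (hA.strict _ _ h).ne (by rw [hij])
    · exact (hA.strict _ _ h).ne (by rw [hij])
  have hspan := (Module.End.eigenvectors_linearIndependent' _ lam hinj v
    hv).span_eq_top_of_card_eq_finrank' (by simp)
  have hb : b ∈ Submodule.span ℂ (Set.range v) := hspan ▸ Submodule.mem_top
  -- By linearity an eigenvector suffices: the projection kills the unstable ones, and the powers of
  -- a stable eigenvalue decay.
  induction hb using Submodule.span_induction with
  | mem x hx =>
    obtain ⟨i, rfl⟩ := hx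
    have hi : toComplex A *ᵥ v i = lam i • v i := by simpa using (hv i).apply_eq_smul
    simp_rw [mulVec_pow_eigen hi, Matrix.mulVec_smul]
    by_cases hik : (i : ℕ) < k
    · rw [toComplex_sub, toComplex_one, Matrix.sub_mulVec, Matrix.one_mulVec,
        hP.proj_mulVec_eigen (hA.unstable i hik) hi, sub_self]
      simp
    · have h0 := tendsto_pow_atTop_nhds_zero_of_norm_lt_one (hA.stable i (by omega))
      simpa using h0.smul_const (toComplex (1 - P * Pᵀ) *ᵥ v i)
  | zero => simp
  | add x y _ _ hx hy => simpa [Matrix.mulVec_add] using hx.add hy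
  | smul a x _ hx => simpa [Matrix.mulVec_smul] using hx.const_smul a

end IsUnstableBasis

/-! ### Controllability of the `τ`-hop unstable dynamics -/

/-- The Hautus test: in a controllable pair no left eigenvector is annihilated by `B`. -/
lemma Controllable.vecMul_ne_zero (hAB : Controllable A B) {μ : ℂ} {w : Fin n → ℂ} (hw : w ≠ 0)
    (hμ : w ᵥ* toComplex A = μ • w) : w ᵥ* toComplex B ≠ 0 := by
  intro hB
  refine hw (funext fun i => ?_)
  obtain ⟨N, u, hu⟩ := hAB 0 (Pi.single i 1)
  -- The kernel of `w` would contain every state reachable from 0, hence every standard basis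
  -- vector.
  have key : ∀ t, w ⬝ᵥ (fun j => (linState A B 0 u t j : ℂ)) = 0 := by
    intro t
    induction t with
    | zero => simp [linState, dotProduct]
    | succ t ih =>
      have h : (fun j => (linState A B 0 u (t + 1) j : ℂ)) =
          toComplex A *ᵥ (fun j => (linState A B 0 u t j : ℂ)) +
            toComplex B *ᵥ fun j => (u t j : ℂ) := by
        rw [toComplex_mulVec, toComplex_mulVec]
        funext j
        simp [linState]
      rw [h, dotProduct_add, Matrix.dotProduct_mulVec, Matrix.dotProduct_mulVec, hB, hμ,
        smul_dotProduct, ih]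
      simp
  have h := key N
  have h2 : (fun l => ((Pi.single i (1 : ℝ) : Fin n → ℝ) l : ℂ)) = Pi.single i 1 := by
    funext l
    by_cases hl : l = i
    · subst hl; simp
    · simp [hl]
  rw [hu, h2] at h
  simpa using h

lemma exists_left_eigenvector {A : Matrix (Fin n) (Fin n) ℂ} {μ : ℂ}
    (h : Module.End.HasEigenvalue (Matrix.toLin' A) μ) :
    ∃ w : Fin n → ℂ, w ≠ 0 ∧ w ᵥ* A = μ • w := by
  obtain ⟨v, hv⟩ := h.exists_hasEigenvector
  have hv' : A *ᵥ v = μ • v := by simpa using hv.apply_eq_smul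
  have hdet : (A - μ • 1).det = 0 :=
    Matrix.exists_mulVec_eq_zero_iff.1 ⟨v, hv.2, by
      rw [Matrix.sub_mulVec, hv', Matrix.smul_mulVec, Matrix.one_mulVec, sub_self]⟩
  obtain ⟨w, hw, h⟩ := Matrix.exists_vecMul_eq_zero_iff.2 hdet
  refine ⟨w, hw, ?_⟩
  rw [Matrix.vecMul_sub, Matrix.vecMul_smul, Matrix.vecMul_one] at h
  exact sub_eq_zero.1 h

/-- For large `τ` the `τ`-hop unstable dynamics admit a deadbeat feedback. -/
theorem eventually_exists_nilpotent_hop (hA : SpectralProperty A k lam) (hAB : Controllable A B)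
    (hP : IsUnstableBasis A P) :
    ∀ᶠ t : ℕ in atTop, ∃ K : Matrix (Fin m) (Fin k) ℝ,
      (unstableBlock A P ^ (t + 1) + hopInput A B P (t + 1) * K) ^ k = 0 := by
  let e : Fin k → Fin n := Fin.castLE hA.le
  choose w hw0 hw using fun i : Fin k => exists_left_eigenvector (hA.eigen (e i))
  have hB := fun i => hAB.vecMul_ne_zero (hw0 i) (hw i)
  choose j hj using fun i => Function.ne_iff.1 (hB i)
  have hlim : ∀ i, Tendsto (fun t : ℕ => w i ⬝ᵥ (toComplex (1 - P * Pᵀ) *ᵥ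
      (toComplex A ^ t *ᵥ (toComplex B).col (j i)))) atTop (𝓝 0) := by
    intro i
    have h := hP.tendsto_orthogonal hA ((toComplex B).col (j i))
    have hc : Continuous fun x : Fin n → ℂ => w i ⬝ᵥ x := by fun_prop
    have h' := (hc.tendsto 0).comp h
    rwa [dotProduct_zero] at h'
  have hev : ∀ᶠ t : ℕ in atTop, ∀ i, ‖w i ⬝ᵥ (toComplex (1 - P * Pᵀ) *ᵥ
      (toComplex A ^ t *ᵥ (toComplex B).col (j i)))‖ < ‖(w i ᵥ* toComplex B) (j i)‖ :=
    eventually_all.2 fun i => by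
      have h := (hlim i).norm
      rw [norm_zero] at h
      exact h.eventually_lt_const (norm_pos_iff.2 (hj i))
  filter_upwards [hev] with t ht
  have hnorm : ∀ i : Fin k, 1 < ‖lam (e i)‖ := fun i => hA.unstable (e i) i.2
  refine exists_nilpotent_feedback (μ := fun i => lam (e i) ^ (t + 1))
    (q := fun i => w i ᵥ* toComplex P) ?_ ?_ ?_
  · intro i i' hii
    by_contra hne
    -- Distinctness of moduli is what survives powers; merely distinct eigenvalues could acquire
    -- equal powers.
    have h1 : ‖lam (e i)‖ = ‖lam (e i')‖ := by
      have := congrArg norm hii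
      simp only [norm_pow] at this
      exact (pow_left_inj₀ (norm_nonneg _) (norm_nonneg _) (Nat.succ_ne_zero t)).1 this
    rcases lt_or_gt_of_ne hne with h | h
    · exact (hA.strict (e i) (e i') h).ne h1.symm
    · exact (hA.strict (e i') (e i) h).ne h1
  · intro i
    rw [Matrix.vecMul_vecMul, ← toComplex_mul, ← hP.pow_mul_eq, toComplex_mul,
      ← Matrix.vecMul_vecMul, toComplex_pow, vecMul_pow_eigen (hw i), Matrix.smul_vecMul]
  · intro i hzero
    have h1 : w i ⬝ᵥ (toComplex (P * Pᵀ) *ᵥ (toComplex A ^ t *ᵥ (toComplex B).col (j i))) = 0 := by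
      have h2 := congrFun hzero (j i)
      rw [hopInput, Nat.add_sub_cancel, Matrix.vecMul_vecMul, ← toComplex_mul, ← Matrix.mul_assoc,
        ← Matrix.mul_assoc, toComplex_mul, toComplex_mul, toComplex_pow] at h2
      rw [Matrix.mulVec_mulVec, Matrix.dotProduct_mulVec]
      rw [← Matrix.vecMul_vecMul] at h2
      exact h2
    -- If the mode were lost, the decaying orthogonal part would carry all of `λ^t (w B)_j`, whose
    -- modulus is at least that of `(w B)_j`.
    have h2 : w i ⬝ᵥ (toComplex (1 - P * Pᵀ) *ᵥ (toComplex A ^ t *ᵥ (toComplex B).col (j i))) =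
        lam (e i) ^ t * (w i ᵥ* toComplex B) (j i) := by
      rw [toComplex_sub, toComplex_one, Matrix.sub_mulVec, Matrix.one_mulVec, dotProduct_sub, h1,
        sub_zero, Matrix.dotProduct_mulVec, vecMul_pow_eigen (hw i), smul_dotProduct]
      rfl
    have h3 := ht i
    rw [h2, norm_mul, norm_pow] at h3
    have h4 := one_le_pow₀ (hnorm i).le (n := t)
    nlinarith [norm_nonneg ((w i ᵥ* toComplex B) (j i))]

/-! ### Spectral norms and uniformity over the bases -/

section Norms

lemma transpose_l2_opNorm {p q : ℕ} (M : Matrix (Fin p) (Fin q) ℝ) : ‖Mᵀ‖ = ‖M‖ := by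
  rw [← Matrix.conjTranspose_eq_transpose_of_trivial, Matrix.l2_opNorm_conjTranspose]

/-- Only an inequality, since the norm is 0 for `p = 0`. -/
lemma l2_opNorm_one_le {p : ℕ} : ‖(1 : Matrix (Fin p) (Fin p) ℝ)‖ ≤ 1 := by
  rw [← Matrix.diagonal_one, Matrix.l2_opNorm_diagonal]
  exact (pi_norm_le_iff_of_nonneg zero_le_one).2 fun _ => by simp

lemma l2_opNorm_le_one {p q : ℕ} {M : Matrix (Fin p) (Fin q) ℝ} (hM : Mᵀ * M = 1) :
    ‖M‖ ≤ 1 := by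
  have h := Matrix.l2_opNorm_conjTranspose_mul_self M
  rw [Matrix.conjTranspose_eq_transpose_of_trivial, hM] at h
  nlinarith [l2_opNorm_one_le (p := q), norm_nonneg M]

end Norms

/-- For large `τ` all pairs near the `τ`-hop unstable dynamics are stabilizable, uniformly in the
choice of the orthonormal basis of the unstable subspace. -/
theorem exists_uniform_stabilizable (hA : SpectralProperty A k lam) (hAB : Controllable A B) :
    ∃ τ₀ : ℕ, 1 ≤ τ₀ ∧ ∀ τ, τ₀ ≤ τ → ∃ δ : ℝ, 0 < δ ∧
      ∀ P : Matrix (Fin n) (Fin k) ℝ, IsUnstableBasis A P →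
      ∀ (F : Matrix (Fin k) (Fin k) ℝ) (G : Matrix (Fin k) (Fin m) ℝ),
        ‖F - unstableBlock A P ^ τ‖ < δ → ‖G - hopInput A B P τ‖ < δ → Stabilizable F G := by
  -- Without a basis the claim is vacuous, so existence of one need not be proved.
  by_cases hex : ∃ P : Matrix (Fin n) (Fin k) ℝ, IsUnstableBasis A P
  swap
  · exact ⟨1, le_rfl, fun _ _ => ⟨1, one_pos, fun P hP => absurd ⟨P, hP⟩ hex⟩⟩
  obtain ⟨Q, hQ⟩ := hex
  obtain ⟨N, hN⟩ := eventually_atTop.1 (eventually_exists_nilpotent_hop hA hAB hQ)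
  refine ⟨N + 1, by omega, fun τ hτ => ?_⟩
  obtain ⟨K, hK⟩ := hN (τ - 1) (by omega)
  rw [Nat.sub_add_cancel (by omega)] at hK
  obtain ⟨δ, hδ, h⟩ := exists_forall_stabilizable hK
  refine ⟨δ, hδ, fun P hP F G hF hG => ?_⟩
  -- The orthogonal transition matrix between the two bases. Passing to the coordinates of `Q` does
  -- not increase distances, so the tolerance found for `Q` serves every `P`.
  set O : Matrix (Fin k) (Fin k) ℝ := Qᵀ * P with hOdef
  have hPQ : Q * O = P := by rw [hOdef, ← Matrix.mul_assoc, hQ.proj_mul hP]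
  have hO : Oᵀ * O = 1 := by
    rw [hOdef, Matrix.transpose_mul, Matrix.transpose_transpose, Matrix.mul_assoc,
      ← Matrix.mul_assoc Q, hQ.proj_mul hP, hP.1]
  have hO' : O * Oᵀ = 1 := mul_eq_one_comm.1 hO
  have hOn : ‖O‖ ≤ 1 := l2_opNorm_le_one hO
  have hQP : O * Pᵀ = Qᵀ := by
    rw [← hPQ, Matrix.transpose_mul, ← Matrix.mul_assoc, hO', Matrix.one_mul]
  have hM : unstableBlock A Q ^ τ = O * unstableBlock A P ^ τ * Oᵀ := by
    have hQP' : P * Oᵀ = Q := by rw [← Matrix.transpose_inj, ← hQP]; simp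
    rw [hQ.block_pow, hP.block_pow, ← hQP]
    conv_lhs => rw [← hQP']
    simp only [Matrix.mul_assoc]
  refine stabilizable_of_orthogonal hO (h _ _ ?_ ?_)
  · rw [hM, ← Matrix.sub_mul, ← Matrix.mul_sub]
    calc _ ≤ ‖O‖ * ‖F - unstableBlock A P ^ τ‖ * ‖Oᵀ‖ :=
          (Matrix.l2_opNorm_mul _ _).trans
            (mul_le_mul_of_nonneg_right (Matrix.l2_opNorm_mul _ _) (norm_nonneg _))
      _ ≤ 1 * ‖F - unstableBlock A P ^ τ‖ * 1 := by
          rw [transpose_l2_opNorm]; gcongr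
      _ < δ := by simpa using hF
  · have hH : hopInput A B Q τ = O * hopInput A B P τ := by
      rw [hopInput, ← hQP, hopInput]; simp only [Matrix.mul_assoc]
    rw [hH, ← Matrix.mul_sub]
    calc _ ≤ ‖O‖ * ‖G - hopInput A B P τ‖ := Matrix.l2_opNorm_mul _ _
      _ ≤ 1 * ‖G - hopInput A B P τ‖ := by gcongr
      _ < δ := by simpa using hG

end LTSZero

/-! ### Vector norms and elementary estimates -/

namespace LTSZero

section VectorNorm

variable {p q : ℕ}

lemma vnorm_nonneg (v : Fin p → ℝ) : 0 ≤ vnorm v := norm_nonneg _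

lemma vnorm_zero : vnorm (0 : Fin p → ℝ) = 0 := by simp [vnorm]

lemma vnorm_add_le (v w : Fin p → ℝ) : vnorm (v + w) ≤ vnorm v + vnorm w :=
  norm_add_le (WithLp.toLp 2 v) (WithLp.toLp 2 w)

lemma vnorm_sub_le (v w : Fin p → ℝ) : vnorm (v - w) ≤ vnorm v + vnorm w :=
  norm_sub_le (WithLp.toLp 2 v) (WithLp.toLp 2 w)

lemma vnorm_smul (a : ℝ) (v : Fin p → ℝ) : vnorm (a • v) = |a| * vnorm v :=
  norm_smul a (WithLp.toLp 2 v)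

lemma vnorm_single (i : Fin p) : vnorm (Pi.single i (1 : ℝ) : Fin p → ℝ) = 1 := by
  have h : WithLp.toLp 2 (Pi.single i (1 : ℝ) : Fin p → ℝ) = EuclideanSpace.single i 1 := rfl
  rw [vnorm, h]
  simp

lemma abs_le_vnorm (v : Fin p → ℝ) (i : Fin p) : |v i| ≤ vnorm v :=
  PiLp.norm_apply_le (WithLp.toLp 2 v) i

lemma vnorm_mulVec_le (M : Matrix (Fin p) (Fin q) ℝ) (v : Fin q → ℝ) :
    vnorm (M *ᵥ v) ≤ ‖M‖ * vnorm v :=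
  Matrix.l2_opNorm_mulVec M (WithLp.toLp 2 v)

lemma vnorm_mulVec_le_of_le {M : Matrix (Fin p) (Fin q) ℝ} {v : Fin q → ℝ} {a b : ℝ}
    (hM : ‖M‖ ≤ a) (hv : vnorm v ≤ b) : vnorm (M *ᵥ v) ≤ a * b :=
  (vnorm_mulVec_le M v).trans
    (mul_le_mul hM hv (vnorm_nonneg v) ((norm_nonneg M).trans hM))

lemma l2_opNorm_le_of_vnorm_col_le {M : Matrix (Fin p) (Fin q) ℝ} {r : ℝ} (hr : 0 ≤ r)
    (h : ∀ j, vnorm (M.col j) ≤ r) : ‖M‖ ≤ q * r := by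
  rw [Matrix.l2_opNorm_def]
  refine ContinuousLinearMap.opNorm_le_bound _ (by positivity) fun v => ?_
  change vnorm (M *ᵥ v.ofLp) ≤ q * r * vnorm v.ofLp
  have hsum : ∀ s : Finset (Fin q), vnorm (∑ j ∈ s, v.ofLp j • M.col j) ≤
      s.card * (r * vnorm v.ofLp) := by
    intro s
    induction s using Finset.cons_induction with
    | empty => simp [vnorm_zero]
    | cons j s hj ih =>
      rw [Finset.sum_cons, Finset.card_cons]
      refine (vnorm_add_le _ _).trans ?_
      have h1 : vnorm (v.ofLp j • M.col j) ≤ vnorm v.ofLp * r := by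
        rw [vnorm_smul]
        exact mul_le_mul (abs_le_vnorm _ j) (h j) (vnorm_nonneg _) (vnorm_nonneg _)
      push_cast
      linarith
  have h2 : M *ᵥ v.ofLp = ∑ j, v.ofLp j • M.col j := by
    funext i
    simp [Matrix.mulVec, dotProduct, mul_comm]
  rw [h2, mul_assoc]
  simpa using hsum Finset.univ

/-- Lipschitz continuity of the power map on a ball, by telescoping; the bound on `Y ^ N` is carried
along for the induction. -/
lemma exists_l2_opNorm_pow_sub_le (R : ℝ) (hR : 0 ≤ R) (N : ℕ) :
    ∃ b c : ℝ, 0 ≤ b ∧ 0 ≤ c ∧ ∀ X Y : Matrix (Fin p) (Fin p) ℝ, ‖X‖ ≤ R → ‖Y‖ ≤ R →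
      ‖Y ^ N‖ ≤ b ∧ ‖X ^ N - Y ^ N‖ ≤ c * ‖X - Y‖ := by
  induction N with
  | zero => exact ⟨1, 0, zero_le_one, le_rfl, fun X Y _ _ => by
      simpa using l2_opNorm_one_le⟩
  | succ N ih =>
    obtain ⟨b, c, hb, hc, h⟩ := ih
    refine ⟨R * b, R * c + b, by positivity, by positivity, fun X Y hX hY => ?_⟩
    obtain ⟨h1, h2⟩ := h X Y hX hY
    constructor
    · rw [pow_succ']
      exact (norm_mul_le _ _).trans (mul_le_mul hY h1 (norm_nonneg _) hR)
    · have h3 : X ^ (N + 1) - Y ^ (N + 1) = X * (X ^ N - Y ^ N) + (X - Y) * Y ^ N := by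
        rw [pow_succ', pow_succ', mul_sub, sub_mul]; abel
      rw [h3]
      calc _ ≤ ‖X‖ * ‖X ^ N - Y ^ N‖ + ‖X - Y‖ * ‖Y ^ N‖ :=
            (norm_add_le _ _).trans (add_le_add (norm_mul_le _ _) (norm_mul_le _ _))
        _ ≤ R * (c * ‖X - Y‖) + ‖X - Y‖ * b := by gcongr
        _ = (R * c + b) * ‖X - Y‖ := by ring

end VectorNorm

/-! ### Error analysis of a run -/

variable {n m k : ℕ} {A : Matrix (Fin n) (Fin n) ℝ} {B : Matrix (Fin n) (Fin m) ℝ}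

/-- Accumulated noise over `s` open-loop steps. -/
lemma exists_vnorm_openLoop_le (A : Matrix (Fin n) (Fin n) ℝ) (s : ℕ) :
    ∃ c : ℝ, 0 ≤ c ∧ ∀ (C : ℝ) (y η : ℕ → Fin n → ℝ), (∀ r, vnorm (η r) < C) →
      (∀ r < s, y (r + 1) = A *ᵥ y r + η r) → vnorm (y s - A ^ s *ᵥ y 0) ≤ c * C := by
  induction s with
  | zero => exact ⟨0, le_rfl, fun C y η _ _ => by simp [vnorm_zero]⟩
  | succ s ih =>
    obtain ⟨c, hc, h⟩ := ih
    refine ⟨‖A‖ * c + 1, by positivity, fun C y η hη hy => ?_⟩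
    have h1 := h C y η hη fun r hr => hy r (by omega)
    have h2 : y (s + 1) - A ^ (s + 1) *ᵥ y 0 = A *ᵥ (y s - A ^ s *ᵥ y 0) + η s := by
      rw [hy s (by omega), pow_succ', ← Matrix.mulVec_mulVec, Matrix.mulVec_sub]
      abel
    rw [h2]
    calc _ ≤ ‖A‖ * (c * C) + C :=
          (vnorm_add_le _ _).trans (add_le_add (vnorm_mulVec_le_of_le le_rfl h1) (hη s).le)
      _ = _ := by ring

lemma injTime_add_le_of_lt {T τ : ℕ} {ω : Fin m → ℕ} {i j : Fin m} (h : i < j) :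
    injTime T τ ω i + τ ≤ injTime T τ ω j := by
  have h1 : ∑ l ∈ Finset.Iic i, ω l ≤ ∑ l ∈ Finset.Iic j, ω l :=
    Finset.sum_le_sum_of_subset (Finset.Iic_subset_Iic.2 h.le)
  have h2 : ((i : ℕ) + 1) * τ ≤ j * τ := Nat.mul_le_mul_right _ h
  rw [add_mul, one_mul] at h2
  unfold injTime
  omega

lemma injTime_mono {T τ : ℕ} {ω : Fin m → ℕ} {i j : Fin m} (h : i ≤ j) :
    injTime T τ ω i ≤ injTime T τ ω j := by
  rcases h.eq_or_lt with rfl | h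
  · exact le_rfl
  · exact (Nat.le_add_right _ _).trans (injTime_add_le_of_lt h)

namespace IsRun

variable {C α γ δ : ℝ} {T τ : ℕ} {η x : ℕ → Fin n → ℝ} {u : ℕ → Fin m → ℝ} {ω : Fin m → ℕ}
  {Phat : Matrix (Fin n) (Fin k) ℝ} {Mhat : Matrix (Fin k) (Fin k) ℝ}
  {Bhat : Matrix (Fin k) (Fin m) ℝ}

lemma input_eq_zero (h : IsRun A B C α γ δ T τ η x u ω Phat Mhat Bhat) (i : Fin m) {s : ℕ}
    (hs : 0 < s) (hsτ : s < τ) : u (injTime T τ ω i + s) = 0 := by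
  refine h.openLoop _ ⟨i, by omega⟩ fun j hj => ?_
  rcases le_or_gt j i with hji | hij
  · have := injTime_mono (T := T) (τ := τ) (ω := ω) hji
    omega
  · have := injTime_add_le_of_lt (T := T) (τ := τ) (ω := ω) hij
    omega

lemma noise_pos (h : IsRun A B C α γ δ T τ η x u ω Phat Mhat Bhat) : 0 < C :=
  (vnorm_nonneg _).trans_lt (h.noise 0)

lemma state_pos (h : IsRun A B C α γ δ T τ η x u ω Phat Mhat Bhat) (hδ : 0 < δ) (i : Fin m) :
    0 < vnorm (x (injTime T τ ω i)) := by
  have h1 := h.noise_pos.trans (h.stopping i).2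
  exact pos_of_mul_pos_right h1 hδ.le

lemma residual_le (h : IsRun A B C α γ δ T τ η x u ω Phat Mhat Bhat) (hγ : 0 ≤ γ) (hδ : 0 < δ)
    (i : Fin m) : vnorm (x (injTime T τ ω i) - (Phat * Phatᵀ) *ᵥ x (injTime T τ ω i)) ≤
      γ * vnorm (x (injTime T τ ω i)) := by
  refine (h.stopping i).1.le.trans ?_
  -- For `k = 0` the quotient is `0` by the convention on division by zero, matching `ε = 0`.
  have hε : 0 ≤ δ / √(2 * k) := by positivity
  refine mul_le_mul_of_nonneg_right ?_ (vnorm_nonneg _)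
  nlinarith [mul_nonneg hε hγ]

end IsRun

/-- A hop is one injection step followed by `s` open-loop steps, so only noise separates the state
from the exact response. The constant precedes all data of the run and is thus uniform in them. -/
lemma exists_vnorm_hop_le (A : Matrix (Fin n) (Fin n) ℝ) (B : Matrix (Fin n) (Fin m) ℝ) (k s : ℕ) :
    ∃ c : ℝ, 0 ≤ c ∧ ∀ {C α γ δ : ℝ} {T : ℕ} {η x : ℕ → Fin n → ℝ} {u : ℕ → Fin m → ℝ}
      {ω : Fin m → ℕ} {Phat : Matrix (Fin n) (Fin k) ℝ} {Mhat : Matrix (Fin k) (Fin k) ℝ}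
      {Bhat : Matrix (Fin k) (Fin m) ℝ},
      IsRun A B C α γ δ T (s + 1) η x u ω Phat Mhat Bhat → ∀ i : Fin m,
      vnorm (x (injTime T (s + 1) ω i + (s + 1)) - A ^ s *ᵥ (A *ᵥ x (injTime T (s + 1) ω i) +
        (α * vnorm (x (injTime T (s + 1) ω i))) • B.col i)) ≤ c * C := by
  obtain ⟨c, hc, h⟩ := exists_vnorm_openLoop_le A s
  refine ⟨c + ‖A ^ s‖, by positivity, fun {C α γ δ T η x u ω Phat Mhat Bhat} hrun i => ?_⟩
  set t := injTime T (s + 1) ω i with ht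
  have h1 := h C (fun r => x (t + 1 + r)) (fun r => η (t + 1 + r)) (fun r => hrun.noise _)
    fun r hr => by
      have h2 : u (t + 1 + r) = 0 := by
        rw [add_assoc]
        exact hrun.input_eq_zero i (by omega) (by omega)
      change x (t + 1 + r + 1) = _
      rw [hrun.dynamics, h2, Matrix.mulVec_zero, add_zero]
  have h3 : A *ᵥ x t + (α * vnorm (x t)) • B.col i = x (t + 1) - η t := by
    rw [hrun.dynamics, hrun.inject, Matrix.mulVec_smul, Matrix.mulVec_single_one]
    abel
  have h4 : x (t + (s + 1)) - A ^ s *ᵥ (x (t + 1) - η t) =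
      (x (t + 1 + s) - A ^ s *ᵥ x (t + 1)) + A ^ s *ᵥ η t := by
    rw [Matrix.mulVec_sub, show t + (s + 1) = t + 1 + s by ring]
    abel
  rw [h3, h4, add_mul]
  exact (vnorm_add_le _ _).trans
    (add_le_add h1 (vnorm_mulVec_le_of_le le_rfl (hrun.noise t).le))

/-- The error of one column of the estimate of `B_τ`. -/
lemma vnorm_estimate_sub_le {N : ℕ} {P Phat : Matrix (Fin n) (Fin k) ℝ}
    {L Mhat : Matrix (Fin k) (Fin k) ℝ} {x y b : Fin n → ℝ} {bhat : Fin k → ℝ}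
    {α c cM d : ℝ} (hα : 0 < α) (hd : d ≤ 1) (hx : 0 < vnorm x)
    (hP : ‖P‖ ≤ 1) (hL : L = Pᵀ * A ^ N * P) (hPhat : ‖Phat - P‖ ≤ d) (hM : ‖Mhat - L‖ ≤ cM * d)
    (hres : vnorm (x - (Phat * Phatᵀ) *ᵥ x) ≤ d * vnorm x)
    (hy : vnorm (y - A ^ N *ᵥ x - (α * vnorm x) • b) ≤ c * (d * vnorm x))
    (hbhat : bhat = (1 / (α * vnorm x)) • (Phatᵀ *ᵥ y - Mhat *ᵥ (Phatᵀ *ᵥ x))) :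
    vnorm (bhat - Pᵀ *ᵥ b) ≤
      d * (vnorm b + (2 * c + 6 * ‖A ^ N‖ + 2 * cM) / α) := by
  have hd0 : 0 ≤ d := (norm_nonneg _).trans hPhat
  have hαx : 0 < α * vnorm x := mul_pos hα hx
  have hPt : ‖Pᵀ‖ ≤ 1 := by rwa [transpose_l2_opNorm]
  have hPhatn : ‖Phat‖ ≤ 2 := by
    have := norm_add_le (Phat - P) P
    rw [sub_add_cancel] at this
    linarith
  have hPhatt : ‖Phatᵀ‖ ≤ 2 := by rwa [transpose_l2_opNorm]
  have hdiff : ‖(Phat - P)ᵀ‖ ≤ d := by rwa [transpose_l2_opNorm]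
  have hLn : ‖L‖ ≤ ‖A ^ N‖ := by
    rw [hL]
    calc _ ≤ ‖Pᵀ‖ * ‖A ^ N‖ * ‖P‖ := (Matrix.l2_opNorm_mul _ _).trans
          (mul_le_mul_of_nonneg_right (Matrix.l2_opNorm_mul _ _) (norm_nonneg _))
      _ ≤ 1 * ‖A ^ N‖ * 1 := by gcongr
      _ = _ := by ring
  have hcancel : (α * vnorm x) • bhat = Phatᵀ *ᵥ y - Mhat *ᵥ (Phatᵀ *ᵥ x) := by
    rw [hbhat, smul_smul, mul_one_div_cancel hαx.ne', one_smul]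
  set X := vnorm x with hX
  have hLx : L *ᵥ (Pᵀ *ᵥ x) = Pᵀ *ᵥ (A ^ N *ᵥ (P *ᵥ (Pᵀ *ᵥ x))) := by
    rw [hL]; simp only [Matrix.mulVec_mulVec, Matrix.mul_assoc]
  -- Each term is small relative to `X`. The last three split `x - P Pᵀ x` into the residual
  -- controlled by the stopping rule and the error of replacing `Phat` by `P`; without them `L (Pᵀ
  -- x)` could be far from `Pᵀ (A ^ N x)`.
  have hdecomp : (α * X) • (bhat - Pᵀ *ᵥ b) =
      (α * X) • ((Phat - P)ᵀ *ᵥ b) + Phatᵀ *ᵥ (y - A ^ N *ᵥ x - (α * X) • b) +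
      (Phat - P)ᵀ *ᵥ (A ^ N *ᵥ x) - (Mhat - L) *ᵥ (Phatᵀ *ᵥ x) - L *ᵥ ((Phat - P)ᵀ *ᵥ x) +
      Pᵀ *ᵥ (A ^ N *ᵥ (x - (Phat * Phatᵀ) *ᵥ x)) +
      Pᵀ *ᵥ (A ^ N *ᵥ ((Phat - P) *ᵥ (Phatᵀ *ᵥ x))) +
      Pᵀ *ᵥ (A ^ N *ᵥ (P *ᵥ ((Phat - P)ᵀ *ᵥ x))) := by
    rw [smul_sub, hcancel]
    simp only [Matrix.transpose_sub, Matrix.sub_mulVec, Matrix.mulVec_sub, Matrix.mulVec_smul,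
      ← Matrix.mulVec_mulVec, smul_sub, hLx]
    abel
  have b1 : vnorm ((α * X) • ((Phat - P)ᵀ *ᵥ b)) ≤ α * X * (d * vnorm b) := by
    rw [vnorm_smul, abs_of_pos hαx]
    exact mul_le_mul_of_nonneg_left (vnorm_mulVec_le_of_le hdiff le_rfl) hαx.le
  have b2 := vnorm_mulVec_le_of_le hPhatt hy
  have bA : vnorm (A ^ N *ᵥ x) ≤ ‖A ^ N‖ * X := vnorm_mulVec_le _ _
  have b3 := vnorm_mulVec_le_of_le hdiff bA
  have bPx : vnorm (Phatᵀ *ᵥ x) ≤ 2 * X := vnorm_mulVec_le_of_le hPhatt le_rfl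
  have b4 := vnorm_mulVec_le_of_le hM bPx
  have bdx : vnorm ((Phat - P)ᵀ *ᵥ x) ≤ d * X := vnorm_mulVec_le_of_le hdiff le_rfl
  have b5 := vnorm_mulVec_le_of_le hLn bdx
  have b6 := vnorm_mulVec_le_of_le hPt
    (vnorm_mulVec_le_of_le (M := A ^ N) le_rfl hres)
  have b7 := vnorm_mulVec_le_of_le hPt
    (vnorm_mulVec_le_of_le (M := A ^ N) le_rfl (vnorm_mulVec_le_of_le hPhat bPx))
  have b8 := vnorm_mulVec_le_of_le hPt
    (vnorm_mulVec_le_of_le (M := A ^ N) le_rfl (vnorm_mulVec_le_of_le hP bdx))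
  have htotal : α * X * vnorm (bhat - Pᵀ *ᵥ b) ≤
      α * X * (d * vnorm b) + (2 * c + 6 * ‖A ^ N‖ + 2 * cM) * d * X := by
    rw [← abs_of_pos hαx, ← vnorm_smul, hdecomp, abs_of_pos hαx]
    refine (vnorm_add_le _ _).trans ((add_le_add_left ((vnorm_add_le _ _).trans
      (add_le_add_left ((vnorm_add_le _ _).trans (add_le_add_left ((vnorm_sub_le _ _).trans
      (add_le_add_left ((vnorm_sub_le _ _).trans (add_le_add_left ((vnorm_add_le _ _).trans
      (add_le_add_left (vnorm_add_le _ _) _)) _)) _)) _)) _)) _).trans ?_)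
    linarith
  have hfin : α * X * (d * vnorm b) + (2 * c + 6 * ‖A ^ N‖ + 2 * cM) * d * X =
      α * X * (d * (vnorm b + (2 * c + 6 * ‖A ^ N‖ + 2 * cM) / α)) := by
    field_simp
  rw [hfin] at htotal
  exact le_of_mul_le_mul_left htotal hαx

lemma l2_opNorm_unstableBlock_le {P : Matrix (Fin n) (Fin k) ℝ} (hP : ‖P‖ ≤ 1) :
    ‖unstableBlock A P‖ ≤ ‖A‖ := by
  have hPt : ‖Pᵀ‖ ≤ 1 := by rwa [transpose_l2_opNorm]
  calc _ ≤ ‖Pᵀ‖ * ‖A‖ * ‖P‖ := (Matrix.l2_opNorm_mul _ _).trans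
        (mul_le_mul_of_nonneg_right (Matrix.l2_opNorm_mul _ _) (norm_nonneg _))
    _ ≤ 1 * ‖A‖ * 1 := by gcongr
    _ = _ := by ring

/-- The estimates of a run with small parameters are close to the `τ`-hop unstable dynamics. -/
theorem IsRun.exists_estimate_le (A : Matrix (Fin n) (Fin n) ℝ) (B : Matrix (Fin n) (Fin m) ℝ)
    (k : ℕ) {τ : ℕ} (hτ : 1 ≤ τ) {α : ℝ} (hα : 0 < α) :
    ∃ c : ℝ, 0 < c ∧ ∀ {d C γ δ : ℝ} {T : ℕ} {η x : ℕ → Fin n → ℝ} {u : ℕ → Fin m → ℝ}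
      {ω : Fin m → ℕ} {P Phat : Matrix (Fin n) (Fin k) ℝ} {Mhat : Matrix (Fin k) (Fin k) ℝ}
      {Bhat : Matrix (Fin k) (Fin m) ℝ},
      d ≤ 1 → 0 < γ → γ ≤ d → 0 < δ → δ ≤ d →
      IsRun A B C α γ δ T τ η x u ω Phat Mhat Bhat → IsUnstableBasis A P →
      ‖Phat - P‖ ≤ d → ‖Mhat - unstableBlock A P‖ ≤ d →
      ‖Mhat ^ τ - unstableBlock A P ^ τ‖ ≤ c * d ∧ ‖Bhat - hopInput A B P τ‖ ≤ c * d := by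
  obtain ⟨s, rfl⟩ : ∃ s, τ = s + 1 := ⟨τ - 1, by omega⟩
  obtain ⟨c, hc, hhop⟩ := exists_vnorm_hop_le A B k s
  -- The radius `‖A‖ + 1` covers `Mhat` as well, which is within `d ≤ 1` of a block of norm at most
  -- `‖A‖`.
  obtain ⟨_, cM, _, hcM, hpow⟩ :=
    exists_l2_opNorm_pow_sub_le (p := k) (‖A‖ + 1) (by positivity) (s + 1)
  set r := ‖A ^ s * B‖ + (2 * c + 6 * ‖A ^ (s + 1)‖ + 2 * cM) / α with hr
  have hr0 : 0 ≤ r := by positivity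
  -- One constant for both errors: `cM` for the powers, `m * r` for the `m` columns; the `1` makes
  -- it positive.
  refine ⟨cM + m * r + 1, by positivity,
    fun {d C γ δ T η x u ω P Phat Mhat Bhat} hd hγ hγd hδ hδd hrun hP hPhat hMhat => ?_⟩
  have hd0 : 0 ≤ d := hγ.le.trans hγd
  have hPn : ‖P‖ ≤ 1 := l2_opNorm_le_one hP.1
  have hMn := l2_opNorm_unstableBlock_le (A := A) hPn
  have hMhatn : ‖Mhat‖ ≤ ‖A‖ + 1 := by
    have := norm_add_le (Mhat - unstableBlock A P) (unstableBlock A P)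
    rw [sub_add_cancel] at this
    linarith
  have hM : ‖Mhat ^ (s + 1) - unstableBlock A P ^ (s + 1)‖ ≤ cM * d :=
    ((hpow _ _ hMhatn (by linarith)).2).trans (mul_le_mul_of_nonneg_left hMhat hcM)
  have hmr : 0 ≤ m * r * d := by positivity
  have hcMd : 0 ≤ cM * d := by positivity
  refine ⟨hM.trans (by nlinarith), ?_⟩
  have hcol : ∀ i, vnorm ((Bhat - hopInput A B P (s + 1)).col i) ≤ d * r := by
    intro i
    have hx := hrun.state_pos hδ i
    have hy := hhop hrun i
    set xi := x (injTime T (s + 1) ω i) with hxi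
    have h1 : (Bhat - hopInput A B P (s + 1)).col i = Bhat.col i - Pᵀ *ᵥ (A ^ s * B).col i := by
      rw [← Matrix.mulVec_single_one, ← Matrix.mulVec_single_one, ← Matrix.mulVec_single_one,
        Matrix.sub_mulVec, hopInput, Nat.add_sub_cancel, Matrix.mulVec_mulVec, Matrix.mul_assoc]
    have h2 : vnorm ((A ^ s * B).col i) ≤ ‖A ^ s * B‖ := by
      rw [← Matrix.mulVec_single_one]
      simpa [vnorm_single] using vnorm_mulVec_le (A ^ s * B) (Pi.single i 1)
    have hCd : C ≤ d * vnorm xi :=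
      (hrun.stopping i).2.le.trans (mul_le_mul_of_nonneg_right hδd hx.le)
    have hy' : vnorm (x (injTime T (s + 1) ω i + (s + 1)) - A ^ (s + 1) *ᵥ xi -
        (α * vnorm xi) • (A ^ s * B).col i) ≤ c * (d * vnorm xi) := by
      have h3 : A ^ s *ᵥ (A *ᵥ xi + (α * vnorm xi) • B.col i) =
          A ^ (s + 1) *ᵥ xi + (α * vnorm xi) • (A ^ s * B).col i := by
        rw [Matrix.mulVec_add, Matrix.mulVec_smul, Matrix.mulVec_mulVec, ← pow_succ,
          ← Matrix.mulVec_single_one, ← Matrix.mulVec_single_one, Matrix.mulVec_mulVec]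
      rw [h3, ← sub_sub] at hy
      exact hy.trans (mul_le_mul_of_nonneg_left hCd hc)
    have h4 := vnorm_estimate_sub_le hα hd hx hPn (hP.block_pow _) hPhat hM
      ((hrun.residual_le hγ.le hδ i).trans (mul_le_mul_of_nonneg_right hγd hx.le)) hy'
      (hrun.estimate i)
    rw [h1]
    refine h4.trans (mul_le_mul_of_nonneg_left ?_ hd0)
    rw [hr]
    linarith
  refine (l2_opNorm_le_of_vnorm_col_le (by positivity) hcol).trans ?_
  nlinarith

end LTSZero

theorem mainTheorem4 {n m k : ℕ} (A : Matrix (Fin n) (Fin n) ℝ) (B : Matrix (Fin n) (Fin m) ℝ)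
    (lam : Fin n → ℂ) (hA : LTSZero.SpectralProperty A k lam)
    (hAB : LTSZero.Controllable A B) :
    ∃ τ₀ : ℕ, 1 ≤ τ₀ ∧ ∀ τ : ℕ, τ₀ ≤ τ →
      -- estimates of any origin
      (∃ δ₀ : ℝ, 0 < δ₀ ∧
        ∀ (P₁ : Matrix (Fin n) (Fin k) ℝ), LTSZero.IsUnstableBasis A P₁ →
        ∀ (Mhat : Matrix (Fin k) (Fin k) ℝ) (Bhat : Matrix (Fin k) (Fin m) ℝ),
          ‖Mhat ^ τ - LTSZero.unstableBlock A P₁ ^ τ‖ < δ₀ →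
          ‖Bhat - LTSZero.hopInput A B P₁ τ‖ < δ₀ →
          LTSZero.Stabilizable (Mhat ^ τ) Bhat) ∧
      -- the estimates computed by the algorithm
      (∀ α : ℝ, 0 < α → ∃ γ₀ δ₀ : ℝ, 0 < γ₀ ∧ 0 < δ₀ ∧
        ∀ (C γ δ : ℝ) (T : ℕ) (η x : ℕ → Fin n → ℝ) (u : ℕ → Fin m → ℝ) (ω : Fin m → ℕ)
          (P₁ Phat : Matrix (Fin n) (Fin k) ℝ) (Mhat : Matrix (Fin k) (Fin k) ℝ)
          (Bhat : Matrix (Fin k) (Fin m) ℝ),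
          0 < γ → γ < γ₀ → 0 < δ → δ < δ₀ →
          LTSZero.IsRun A B C α γ δ T τ η x u ω Phat Mhat Bhat →
          LTSZero.IsUnstableBasis A P₁ →
          ‖Phat - P₁‖ < δ₀ →
          ‖Mhat - LTSZero.unstableBlock A P₁‖ < δ₀ →
          LTSZero.Stabilizable (Mhat ^ τ) Bhat) := by
  obtain ⟨τ₀, hτ₀, h⟩ := LTSZero.exists_uniform_stabilizable hA hAB
  refine ⟨τ₀, hτ₀, fun τ hτ => ?_⟩
  obtain ⟨δ, hδ, hstab⟩ := h τ hτ
  refine ⟨⟨δ, hδ, fun P hP Mhat Bhat => hstab P hP _ _⟩, fun α hα => ?_⟩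
  obtain ⟨c, hc, hest⟩ := LTSZero.IsRun.exists_estimate_le A B k (hτ₀.trans hτ) hα
  -- A single `d` serves as `γ₀` and as `δ₀`, bringing both estimates within the tolerance of (a).
  obtain ⟨d, hd0, hd1, hd⟩ : ∃ d : ℝ, 0 < d ∧ d ≤ 1 ∧ c * d < δ := by
    refine ⟨min 1 (δ / (2 * c)), by positivity, min_le_left _ _, ?_⟩
    calc c * min 1 (δ / (2 * c)) ≤ c * (δ / (2 * c)) :=
          mul_le_mul_of_nonneg_left (min_le_right _ _) hc.le
      _ = δ / 2 := by field_simp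
      _ < δ := half_lt_self hδ
  refine ⟨d, d, hd0, hd0, ?_⟩
  intro C γ δ' T η x u ω P Phat Mhat Bhat hγ hγd hδ' hδd hrun hP hPhat hMhat
  obtain ⟨h1, h2⟩ := hest hd1 hγ hγd.le hδ' hδd.le hrun hP hPhat.le hMhat.le
  exact hstab P hP _ _ (h1.trans_lt hd) (h2.trans_lt hd)
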